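/- Let $N\ge 2$, $\nu\ge 2$, $n\ge 0$ be integers and $r>0$. Let $\vec x$ be the vector of $(2\nu+1)N+1$ independent complex variables consisting of the coordinates of the initial positions $q_i^0$ and velocities $v_i^0$ ($1\le i\le N$, each with $\nu$ components), the masses $m_1,\dots,m_N$ and the size $L$ of the torus. Write $\mathbb K_0=\mathbb C(\vec x)$, and let $\overline{\mathbb K}_0$ be its algebraic closure. $\langle\cdot,\cdot\rangle$ denotes the bilinear form $\langle u,w\rangle=\sum_c u_cw_c$. A discrete orbit structure $(\Sigma,\mathcal A,\vec\tau)$ consists of a sequence of pairs $\sigma_k=(i_k,j_k)$, $i_k\ne j_k$, of labels in $\{1,\dots,N\}$, of vectors $a_k\in\mathbb Z^\nu$, and of elements $\tau_k\in\overline{\mathbb K}_0$ ($k=1,\dots,n$) such that, recursively, $\tau_k$ is a root of $$\|w_k\|^2\tau^2+2\langle w_k,u_k\rangle\tau+\|u_k\|^2-4r^2=0,\qquad w_k=v^{k-1}_{i_k}-v^{k-1}_{j_k},\quad u_k=q^{k-1}_{i_k}-q^{k-1}_{j_k}-L a_k ,$$ where $\|u\|^2=\langle u,u\rangle$, $q_i^k=q_i^{k-1}+\tau_kv_i^{k-1}$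 for all $i$, $v_i^k=v_i^{k-1}$ for $i\notin\sigma_k$, and, with $u'_k=q^k_{i_k}-q^k_{j_k}-La_k$, $$v^k_{i_k}=v^{k-1}_{i_k}-\tfrac{m_{j_k}}{m_{i_k}+m_{j_k}}\tfrac1{2r^2}\langle w_k,u'_k\rangle u'_k,\qquad v^k_{j_k}=v^{k-1}_{j_k}+\tfrac{m_{i_k}}{m_{i_k}+m_{j_k}}\tfrac1{2r^2}\langle w_k,u'_k\rangle u'_k .$$ The neutrality equations are the $\nu n$ homogeneous linear equations $$W^{(k)}_{i_k}-\alpha_kv^{k-1}_{i_k}=W^{(k)}_{j_k}-\alpha_kv^{k-1}_{j_k}\quad(1\le k\le n),\qquad W^{(k)}_i=W_i+\sum_{l<k}\alpha_l\,(v_i^l-v_i^{l-1}),$$ for the $\nu N+n$ unknowns $W=(W_1,\dots,W_N)$, $W_i$ with $\nu$ components, and $\alpha_1,\dots,\alpha_n$ (the advances). An orbit is non-sufficient if its neutral space, the space of the solutions $W$, has dimension greater than $\nu+1$; this is expressed by the vanishing of all minors of order $\nu N+n-\nu-1$ of this system. Let $f_1,\dots,f_s\in\overline{\mathbb K}_0$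 be a finite family that spans the same complex vector space as these minors (for instance, the minors themselves), and let the non-sufficiency polynomial $P_k\in\mathbb C[\vec x]$ be the numerator, in lowest terms, of the product of all conjugates of $f_k$ over $\mathbb K_0$ (the roots of its minimal polynomial). Then each of $P_1,\dots,P_s$ is homogeneous in the mass variables $m_1,\dots,m_N$ (all of its monomials have the same total degree in $m_1,\dots,m_N$). Consequently, if $P_1,\dots,P_s$ are not all identically zero, then every common divisor $Q\in\mathbb C[\vec x]$ of them is also homogeneous in the masses. -/

import Mathlib

noncomputable section

namespace HardBall

/-- The coordinates of the vector of initial data of `N` balls in dimension `ν`: positions,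
velocities, masses and the size `L` of the torus, `(2 * ν + 1) * N + 1` variables in total. -/
inductive Var (N ν : ℕ) : Type
  | pos (i : Fin N) (c : Fin ν)
  | vel (i : Fin N) (c : Fin ν)
  | mass (i : Fin N)
  | size

/-- Polynomials with complex coefficients in the initial data. -/
abbrev Poly (N ν : ℕ) : Type := MvPolynomial (Var N ν) ℂ

/-- The field of rational functions of the initial data. -/
abbrev RatField (N ν : ℕ) : Type := FractionRing (Poly N ν)

/-- The field of all algebraic functions of the initial data. -/
abbrev AlgField (N ν : ℕ) : Type := AlgebraicClosure (RatField N ν)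

/-- The variable `x`, regarded as an algebraic function. -/
def coord {N ν : ℕ} (x : Var N ν) : AlgField N ν :=
  algebraMap (RatField N ν) (AlgField N ν)
    (algebraMap (Poly N ν) (RatField N ν) (MvPolynomial.X x))

/-- Positions (lifted to the covering space) and velocities of all balls. -/
structure State (N ν : ℕ) where
  q : Fin N → Fin ν → AlgField N ν
  v : Fin N → Fin ν → AlgField N ν

/-- A symbolic collision sequence of length `n` together with its adjustment vectors: the
`k`-th collision takes place between the balls `i k` and `j k`, and the difference of their
lifted positions is to be corrected by the lattice vector `L • a k`. -/
structure CollisionScheme (N ν n : ℕ) where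
  i : Fin n → Fin N
  j : Fin n → Fin N
  ne : ∀ k, i k ≠ j k
  a : Fin n → Fin ν → ℤ

namespace CollisionScheme

variable {N ν n : ℕ}

/-- The relative position `q_i - q_j - L a` of the balls of the `k`-th collision. -/
def relPos (C : CollisionScheme N ν n) (k : Fin n) (s : State N ν) : Fin ν → AlgField N ν :=
  fun c => s.q (C.i k) c - s.q (C.j k) c - coord Var.size * (C.a k c : AlgField N ν)

/-- The relative velocity `v_i - v_j` of the balls of the `k`-th collision. -/
def relVel (C : CollisionScheme N ν n) (k : Fin n) (s : State N ν) : Fin ν → AlgField N ν :=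
  fun c => s.v (C.i k) c - s.v (C.j k) c

/-- Free motion during time `t`. -/
def flight (t : AlgField N ν) (s : State N ν) : State N ν where
  q := fun b c => s.q b c + t * s.v b c
  v := s.v

/-- The elastic collision number `k` of two balls of radius `r`: the total momentum of the two
balls is kept, and their relative velocity `w` becomes `w - (2 r²)⁻¹ ⟨w, u⟩ u`, where `u` is the
relative position (for `⟨u, u⟩ = (2 r)²` this is the reflection in the direction `u`). -/
def collide (C : CollisionScheme N ν n) (r : ℝ) (k : Fin n) (s : State N ν) : State N ν where
  q := s.q
  v := fun b c =>
    let M : AlgField N ν := coord (Var.mass (C.i k)) + coord (Var.mass (C.j k))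
    let J : AlgField N ν := algebraMap ℂ (AlgField N ν) ((1 / (2 * r ^ 2) : ℝ) : ℂ) *
      (C.relVel k s ⬝ᵥ C.relPos k s) * C.relPos k s c
    if b = C.i k then s.v b c - coord (Var.mass (C.j k)) / M * J
    else if b = C.j k then s.v b c + coord (Var.mass (C.i k)) / M * J
    else s.v b c

/-- `C.orbit r τ k` is the state right after the first `k` collisions, when `τ` lists the times
that elapse between consecutive collisions. The state number `0` is given by the variables. -/
def orbit (C : CollisionScheme N ν n) (r : ℝ) (τ : Fin n → AlgField N ν) : ℕ → State N ν
  | 0 => ⟨fun b c => coord (Var.pos b c), fun b c => coord (Var.vel b c)⟩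
  | k + 1 =>
    if h : k < n then C.collide r ⟨k, h⟩ (flight (τ ⟨k, h⟩) (C.orbit r τ k))
    else C.orbit r τ k

end CollisionScheme

/-- A discrete orbit structure for `N` balls of radius `r`: a symbolic collision sequence, the
adjustment vectors, and for each collision a root `τ k` of the quadratic equation saying that,
a time `τ k` after the previous collision, the two balls have distance `2 r`. If the quadratic
equation is irreducible over the field generated by the earlier data, its two roots are
conjugate; if it is reducible, the structure records which root is used. -/
structure OrbitStructure (N ν n : ℕ) (r : ℝ) extends CollisionScheme N ν n where
  τ : Fin n → AlgField N ν
  root : ∀ k : Fin n,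
    let w := toCollisionScheme.relVel k (toCollisionScheme.orbit r τ k)
    let u := toCollisionScheme.relPos k (toCollisionScheme.orbit r τ k)
    (w ⬝ᵥ w) * τ k ^ 2 + 2 * (w ⬝ᵥ u) * τ k +
      ((u ⬝ᵥ u) - algebraMap ℂ (AlgField N ν) ((4 * r ^ 2 : ℝ) : ℂ)) = 0

namespace OrbitStructure

variable {N ν n : ℕ} {r : ℝ}

/-- The velocities right after the first `k` collisions. -/
def V (S : OrbitStructure N ν n r) (k : ℕ) : Fin N → Fin ν → AlgField N ν :=
  (S.toCollisionScheme.orbit r S.τ k).v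

/-- A pair `(W, α)` of an infinitesimal translation `W` of the initial positions and of numbers
`α k` (the advances of the collisions) is encoded by `x`, with `W b c = x (inl (b, c))` and
`α k = x (inr k)`. Up to the collision `k`, the translation is transported into
`W k = W + ∑ l < k, α l • (V (l + 1) - V l)`. -/
def transported (S : OrbitStructure N ν n r) (x : (Fin N × Fin ν) ⊕ Fin n → AlgField N ν)
    (k : Fin n) (b : Fin N) (c : Fin ν) : AlgField N ν :=
  x (Sum.inl (b, c)) +
    ∑ l ∈ Finset.univ.filter (fun l : Fin n => l < k),
      x (Sum.inr l) * (S.V (l + 1) b c - S.V l b c)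

/-- The linear map whose kernel is the neutral space: `W` is neutral with advances `α` if and
only if, for every collision `k`, the vector `W k - α k • V k` lies in the generator space of
the collision cylinder, i.e. has equal components at the two colliding balls. -/
def neutralityMap (S : OrbitStructure N ν n r) :
    ((Fin N × Fin ν) ⊕ Fin n → AlgField N ν) →ₗ[AlgField N ν]
      (Fin n × Fin ν → AlgField N ν) where
  toFun x p :=
    (S.transported x p.1 (S.i p.1) p.2 - x (Sum.inr p.1) * S.V p.1 (S.i p.1) p.2) -
      (S.transported x p.1 (S.j p.1) p.2 - x (Sum.inr p.1) * S.V p.1 (S.j p.1) p.2)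
  map_add' x y := by
    funext p
    simp only [transported, Pi.add_apply, add_mul, Finset.sum_add_distrib]
    ring
  map_smul' t x := by
    funext p
    simp only [transported, Pi.smul_apply, smul_eq_mul, RingHom.id_apply, mul_assoc,
      ← Finset.mul_sum]
    ring

/-- The minors of order `ν N + n - (ν + 1)` of the system of neutrality equations. As its
solution space always contains the `ν` uniform translations and the direction of the flow, all
of these minors vanish if and only if the neutral space has a dimension greater than `ν + 1`,
which is the non-sufficiency of the orbit. -/
def minors (S : OrbitStructure N ν n r) : Set (AlgField N ν) :=
  {f | ∃ (row : Fin (ν * N + n - (ν + 1)) ↪ Fin n × Fin ν)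
      (col : Fin (ν * N + n - (ν + 1)) ↪ (Fin N × Fin ν) ⊕ Fin n),
    f = ((LinearMap.toMatrix' S.neutralityMap).submatrix row col).det}

/-- A finite system of algebraic functions that describes the non-sufficiency: it spans the same
complex vector space as the minors above (the list of these minors is one such system). -/
def IsNonSufficiencySystem (S : OrbitStructure N ν n r) {s : ℕ} (f : Fin s → AlgField N ν) :
    Prop :=
  Submodule.span ℂ (Set.range f) = Submodule.span ℂ S.minors

end OrbitStructure

/-- The product of all conjugates of the algebraic function `f` over the field of rational
functions, read off from the constant term of its minimal polynomial. -/
def conjProd {N ν : ℕ} (f : AlgField N ν) : RatField N ν :=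
  (-1) ^ (minpoly (RatField N ν) f).natDegree * (minpoly (RatField N ν) f).coeff 0

/-- The numerator, in lowest terms, of the product of all conjugates of `f`. For the functions
`f` of a non-sufficiency system these are the non-sufficiency polynomials. -/
def normNum {N ν : ℕ} (f : AlgField N ν) : Poly N ν :=
  IsFractionRing.num (Poly N ν) (conjProd f)

/-- The weight that counts the mass variables only. -/
def massWeight {N ν : ℕ} : Var N ν → ℕ
  | Var.mass _ => 1
  | _ => 0

/-- Homogeneity in the masses: all monomials of `P` have the same total degree in the mass
variables. -/
def HomogeneousInMasses {N ν : ℕ} (P : Poly N ν) : Prop :=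
  ∃ d : ℕ, MvPolynomial.IsWeightedHomogeneous massWeight P d

end HardBall

end

/-! The equations of motion involve the masses only through the ratios m_i/(m_i+m_j), so a common
scaling of all masses leaves the orbit unchanged. Let σ double all masses in the field of rational
functions. The functions algebraic over the fixed field of σ form `massInvariant`, a relatively
algebraically closed field containing the initial positions and velocities, L and the mass ratios.
Hence it contains the collision times, all states (`orbit_mem`), the minors and their complex
combinations f.

The product of the conjugates of such an f is a rational function algebraic over the fixed field.
Powers of σ send it to roots of one polynomial, so some σ^k with k > 0 fixes it. By unique
factorization σ^k fixes its reduced numerator up to a constant, and since 2 is not a root of unity,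
comparing coefficients gives homogeneity. For a divisor Q of a nonzero homogeneous P, all σ^k Q
divide P, so two of them are associated and the same comparison applies.

The delicate point is that a root τ_k is algebraic over the earlier data only if its quadratic does
not degenerate. `OrbitStructure.relVel_sq_ne_zero` proves this by running the orbit backwards: the
initial data are algebraic over equally many later quantities, including all velocities, which are
therefore algebraically independent. -/

noncomputable section

/-! ### Scaling of variables and weighted homogeneity -/

namespace MvPolynomial

variable {σ : Type*} {K : Type*} [Field K] (w : σ → ℕ)

/-- The substitution `x ↦ t ^ w x * x`, which multiplies polynomials of weight `d` by `t ^ d`. -/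
def weightScale (t : Kˣ) : MvPolynomial σ K ≃ₐ[K] MvPolynomial σ K :=
  AlgEquiv.ofAlgHom (aeval fun x => ((t : K) ^ w x) • X x)
    (aeval fun x => (((t⁻¹ : Kˣ) : K) ^ w x) • X x)
    (algHom_ext fun x => by simp [smul_smul]) (algHom_ext fun x => by simp [smul_smul])

@[simp]
theorem weightScale_X (t : Kˣ) (x : σ) :
    weightScale w t (X x) = ((t : K) ^ w x) • X x := by
  simp [weightScale]

theorem coeff_weightScale (t : Kˣ) (p : MvPolynomial σ K) (d : σ →₀ ℕ) :
    (weightScale w t p).coeff d = (t : K) ^ Finsupp.weight w d * p.coeff d := by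
  classical
  induction p using induction_on' with
  | add p q hp hq => simp [hp, hq, mul_add]
  | monomial e a =>
    have h : weightScale w t (monomial e a) = monomial e ((t : K) ^ Finsupp.weight w e * a) := by
      simp only [weightScale, AlgEquiv.ofAlgHom_apply, aeval_monomial, algebraMap_eq,
        Finsupp.prod, smul_eq_C_mul, mul_pow, ← C_pow, Finset.prod_mul_distrib]
      rw [monomial_eq, ← map_prod, Finsupp.prod, ← mul_assoc, ← C_mul, mul_comm a]
      simp only [← pow_mul]
      rw [Finset.prod_pow_eq_pow_sum, Finsupp.weight_apply, Finsupp.sum]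
      simp [mul_comm]
    rw [h, coeff_monomial, coeff_monomial]
    split_ifs with hed
    · rw [hed]
    · simp

theorem coeff_weightScale_pow (t : Kˣ) (k : ℕ) (p : MvPolynomial σ K) (d : σ →₀ ℕ) :
    ((weightScale w t ^ k) p).coeff d = (t : K) ^ (k * Finsupp.weight w d) * p.coeff d := by
  induction k with
  | zero => simp
  | succ k ih =>
    rw [pow_succ', AlgEquiv.mul_apply, coeff_weightScale, ih, add_mul, one_mul, pow_add]
    ring

/-- Eigenvectors of a power of the scaling by a number that is not a root of unity are weighted
homogeneous. -/
theorem exists_isWeightedHomogeneous_of_associated {t : Kˣ}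
    (ht : Function.Injective fun m : ℕ => (t : K) ^ m) {k : ℕ} (hk : 0 < k)
    {p : MvPolynomial σ K} (h : Associated ((weightScale w t ^ k) p) p) :
    ∃ d, IsWeightedHomogeneous w p d := by
  obtain ⟨u, hu⟩ := h.symm
  obtain ⟨c, -, hc⟩ := isUnit_iff_eq_C_of_isReduced.1 u.isUnit
  have key : ∀ d, p.coeff d ≠ 0 → (t : K) ^ (k * Finsupp.weight w d) = c := fun d hd => by
    have := coeff_weightScale_pow w t k p d
    rw [← hu, hc, mul_comm p, coeff_C_mul] at this
    exact (mul_right_cancel₀ hd this).symm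
  by_cases hp : p = 0
  · exact ⟨0, hp ▸ isWeightedHomogeneous_zero K w 0⟩
  obtain ⟨e, he⟩ := ne_zero_iff.1 hp
  exact ⟨Finsupp.weight w e, fun d hd =>
    Nat.eq_of_mul_eq_mul_left hk (ht ((key d hd).trans (key e he).symm))⟩

theorem associated_weightScale_of_isWeightedHomogeneous (t : Kˣ) {p : MvPolynomial σ K} {d : ℕ}
    (h : IsWeightedHomogeneous w p d) : Associated p (weightScale w t p) := by
  refine ⟨Units.map (C : K →+* MvPolynomial σ K).toMonoidHom (t ^ d), ?_⟩
  ext e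
  have hC : ((Units.map (C : K →+* MvPolynomial σ K).toMonoidHom (t ^ d) : (MvPolynomial σ K)ˣ) :
      MvPolynomial σ K) = C ((t : K) ^ d) := by
    rw [← Units.val_pow_eq_pow_val]
    rfl
  rw [coeff_weightScale, hC, mul_comm p, coeff_C_mul]
  by_cases he : p.coeff e = 0
  · simp [he]
  · rw [h he]

/-- Divisors of nonzero weighted homogeneous polynomials are weighted homogeneous. -/
theorem exists_isWeightedHomogeneous_of_dvd {t : Kˣ}
    (ht : Function.Injective fun m : ℕ => (t : K) ^ m) {p q : MvPolynomial σ K} (hp : p ≠ 0)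
    {d : ℕ} (h : IsWeightedHomogeneous w p d) (hq : q ∣ p) :
    ∃ e, IsWeightedHomogeneous w q e := by
  have hdvd : ∀ k : ℕ, (weightScale w t ^ k) q ∣ p := fun k => by
    induction k with
    | zero => simpa
    | succ k ih =>
      rw [pow_succ', AlgEquiv.mul_apply]
      exact (map_dvd _ ih).trans (associated_weightScale_of_isWeightedHomogeneous w t h).symm.dvd
  have hp' : Associates.mk p ≠ 0 := Associates.mk_ne_zero.2 hp
  have := UniqueFactorizationMonoid.fintypeSubtypeDvd (Associates.mk p) hp'
  -- Up to units `p` has finitely many divisors, so two scalings of `q` are associated; undoing the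
  -- smaller one leaves a positive power.
  obtain ⟨a, b, hne, hab⟩ := Finite.exists_ne_map_eq_of_infinite
    fun k : ℕ => (⟨Associates.mk ((weightScale w t ^ k) q), Associates.mk_dvd_mk.2 (hdvd k)⟩ :
      {x // x ∣ Associates.mk p})
  wlog hlt : a < b generalizing a b
  · exact this b a hne.symm hab.symm (lt_of_le_of_ne (not_lt.1 hlt) hne.symm)
  have hass := Associates.mk_eq_mk_iff_associated.1 (congrArg Subtype.val hab)
  refine exists_isWeightedHomogeneous_of_associated w ht (Nat.sub_pos_of_lt hlt) (p := q) ?_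
  rw [← Nat.add_sub_of_le hlt.le, pow_add, AlgEquiv.mul_apply] at hass
  have := (hass.map (weightScale w t ^ a).symm).symm
  rwa [AlgEquiv.symm_apply_apply, AlgEquiv.symm_apply_apply] at this

end MvPolynomial

/-! ### Reduced numerators, fixed fields and constant terms -/

namespace IsFractionRing

variable {A K : Type*} [CommRing A] [IsDomain A] [UniqueFactorizationMonoid A] [Field K]
  [Algebra A K] [IsFractionRing A K]

/-- An automorphism of `A` whose extension fixes `x` fixes the numerator of `x` up to units. -/
theorem associated_num_of_fixed (σ : A ≃+* A) {τ : K →+* K}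
    (hτ : ∀ a, τ (algebraMap A K a) = algebraMap A K (σ a)) {x : K} (hx : τ x = x) :
    Associated (σ (num A x)) (num A x) := by
  have hden : (den A x : A) ≠ 0 := nonZeroDivisors.coe_ne_zero _
  have hrel : IsRelPrime (σ (num A x)) (σ (den A x)) := fun d hd hd' => by
    have h := num_den_reduced A x (d := σ.symm d)
      (by simpa using map_dvd σ.symm hd) (by simpa using map_dvd σ.symm hd')
    simpa using h.map σ
  have hσ : σ (den A x) ≠ 0 := by simp
  have heq : σ (num A x) * den A x = num A x * σ (den A x) := by
    have h := hx
    conv at h => rhs; rw [← mk'_num_den' A x]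
    conv at h => lhs; rw [← mk'_num_den' A x]
    rw [map_div₀, hτ, hτ, div_eq_div_iff (by simp) (by simp)] at h
    apply IsFractionRing.injective A K
    simpa using h
  -- Both fractions are reduced, so each numerator divides the other.
  refine associated_of_dvd_dvd (hrel.dvd_of_dvd_mul_right ⟨_, heq.symm⟩)
    ((num_den_reduced A x).dvd_of_dvd_mul_right ⟨_, heq⟩)

end IsFractionRing

namespace IntermediateField

variable {F K : Type*} [Field F] [Field K] [Algebra F K]

/-- An element that is algebraic over the fixed field of `σ` is fixed by a power of `σ`. -/
theorem exists_pow_apply_eq_of_isAlgebraic_fixedField (σ : Gal(K/F)) {x : K}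
    (hx : IsAlgebraic (fixedField (Subgroup.zpowers σ)) x) : ∃ k : ℕ, 0 < k ∧ (σ ^ k) x = x := by
  obtain ⟨p, hp, hpx⟩ := hx
  have hroot : ∀ k : ℕ, (σ ^ k) x ∈ p.rootSet K := fun k => by
    rw [Polynomial.mem_rootSet]
    refine ⟨hp, ?_⟩
    have h : ((σ ^ k : Gal(K/F)) : K →+* K).comp
        (algebraMap (fixedField (Subgroup.zpowers σ)) K) = algebraMap _ K := by
      ext a
      exact (mem_fixedField_iff _ _).1 a.2 _ (Subgroup.npow_mem_zpowers σ k)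
    have := congrArg ((σ ^ k : Gal(K/F)) : K →+* K) hpx
    rw [Polynomial.aeval_def, Polynomial.hom_eval₂, h, map_zero] at this
    exact this
  obtain ⟨a, b, hne, hab⟩ := Finite.exists_ne_map_eq_of_infinite
    fun k : ℕ => (⟨(σ ^ k) x, hroot k⟩ : p.rootSet K)
  wlog hlt : a < b generalizing a b
  · exact this b a hne.symm hab.symm (lt_of_le_of_ne (not_lt.1 hlt) hne.symm)
  refine ⟨b - a, Nat.sub_pos_of_lt hlt, ?_⟩
  have h := congrArg Subtype.val hab
  simp only at h
  rw [← Nat.add_sub_of_le hlt.le, pow_add, AlgEquiv.mul_apply] at h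
  exact ((σ ^ a).injective h).symm

end IntermediateField

/-- The constant term of the minimal polynomial is algebraic over every field over which the
element is algebraic. -/
theorem isAlgebraic_minpoly_coeff_zero {F K E : Type*} [Field F] [Field K] [Field E] [Algebra F K]
    [Algebra K E] [Algebra F E] [IsScalarTower F K E] [IsAlgClosed E] {x : E}
    (hx : IsAlgebraic F x) : IsAlgebraic F ((minpoly K x).coeff 0) := by
  have hint : IsIntegral K x := (hx.isIntegral).tower_top
  -- Up to sign the constant term is the product of the conjugates over `K`, each of which is also a
  -- root of `minpoly F x`.
  rw [← isAlgebraic_algebraMap_iff (algebraMap K E).injective, ← Polynomial.coeff_map,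
    (IsAlgClosed.splits ((minpoly K x).map (algebraMap K E))).coeff_zero_eq_prod_roots_of_monic
      ((minpoly.monic hint).map _), ← mem_algebraicClosure_iff]
  refine mul_mem (pow_mem (neg_mem (one_mem _)) _) (multiset_prod_mem _ fun y hy => ?_)
  rw [mem_algebraicClosure_iff]
  refine ⟨minpoly F x, minpoly.ne_zero hx.isIntegral, ?_⟩
  have hy' := Polynomial.isRoot_of_mem_roots hy
  have := Polynomial.map_dvd (algebraMap K E) (minpoly.dvd_map_of_isScalarTower F K x)
  rw [Polynomial.map_map, ← IsScalarTower.algebraMap_eq] at this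
  have := hy'.dvd this
  rwa [Polynomial.IsRoot, Polynomial.eval_map, ← Polynomial.aeval_def] at this

end

/-! ### Relatively closed subfields and algebraic independence -/

noncomputable section

/-- A subfield that contains every element of the large field that is algebraic over it. -/
def IntermediateField.IsRelAlgClosed {F E : Type*} [Field F] [Field E] [Algebra F E]
    (A : IntermediateField F E) : Prop :=
  ∀ x : E, IsAlgebraic A x → x ∈ A

namespace IntermediateField

variable {F E : Type*} [Field F] [Field E] [Algebra F E]

theorem isRelAlgClosed_algebraicClosure (K : Type*) [Field K] [Algebra F K] [Algebra K E]
    [IsScalarTower F K E] : ((algebraicClosure K E).restrictScalars F).IsRelAlgClosed := by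
  intro x hx
  change x ∈ algebraicClosure K E
  have : IsAlgebraic (algebraicClosure K E) x := hx
  exact mem_algebraicClosure_iff.2 (this.restrictScalars K)

theorem IsRelAlgClosed.mem_of_quadratic {A : IntermediateField F E} (hA : A.IsRelAlgClosed)
    {a b c t : E} (ha : a ∈ A) (hb : b ∈ A) (hc : c ∈ A) (ha0 : a ≠ 0)
    (h : a * t ^ 2 + b * t + c = 0) : t ∈ A := by
  refine hA t ⟨Polynomial.C ⟨a, ha⟩ * Polynomial.X ^ 2 + Polynomial.C ⟨b, hb⟩ * Polynomial.X +
    Polynomial.C ⟨c, hc⟩, fun h0 => ha0 ?_, ?_⟩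
  · have := congrArg (fun p => Polynomial.coeff p 2) h0
    refine congrArg Subtype.val (a₁ := (⟨a, ha⟩ : A)) (a₂ := 0) ?_
    simpa [Polynomial.coeff_X, Polynomial.coeff_C] using this
  · simpa [IntermediateField.algebraMap_apply] using h

end IntermediateField

theorem dotProduct_mem_of_forall_mem {E S ι : Type*} [Fintype ι] [CommRing E] [SetLike S E]
    [SubringClass S E] {A : S} {u w : ι → E} (hu : ∀ c, u c ∈ A) (hw : ∀ c, w c ∈ A) :
    u ⬝ᵥ w ∈ A :=
  sum_mem fun c _ => mul_mem (hu c) (hw c)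

namespace HardBall

open IntermediateField
open scoped algebraAdjoinAdjoin

variable {N ν n : ℕ}

theorem coord_algebraicIndependent :
    AlgebraicIndependent ℂ (coord : Var N ν → AlgField N ν) := by
  have h := MvPolynomial.algebraicIndependent_X (Var N ν) ℂ
  have := h.map' (f := IsScalarTower.toAlgHom ℂ (Poly N ν) (RatField N ν))
    (IsFractionRing.injective _ _)
  exact this.map' (f := IsScalarTower.toAlgHom ℂ (RatField N ν) (AlgField N ν))
    (algebraMap (RatField N ν) (AlgField N ν)).injective

instance : Finite (Var N ν) := by
  refine Finite.of_injective (β := (Fin N × Fin ν) ⊕ (Fin N × Fin ν) ⊕ Fin N ⊕ Unit)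
    (fun
      | .pos i c => .inl (i, c)
      | .vel i c => .inr (.inl (i, c))
      | .mass i => .inr (.inr (.inl i))
      | .size => .inr (.inr (.inr ()))) ?_
  rintro (_ | _ | _ | _) (_ | _ | _ | _) h <;> simp_all

theorem mass_add_mass_ne_zero {i j : Fin N} (hij : i ≠ j) :
    (coord (Var.mass i) + coord (Var.mass j) : AlgField N ν) ≠ 0 := by
  intro h
  have h0 : (MvPolynomial.X (Var.mass i) + MvPolynomial.X (Var.mass j) : Poly N ν) = 0 :=
    coord_algebraicIndependent (by simpa using h)
  classical
  have := congrArg (MvPolynomial.eval fun x => if x = Var.mass i then (1 : ℂ) else 0) h0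
  simp [hij.symm] at this

theorem mem_of_forall_coord_mem {A : IntermediateField ℂ (AlgField N ν)}
    (hA : A.IsRelAlgClosed) (h : ∀ x, coord x ∈ A) (z : AlgField N ν) : z ∈ A := by
  have hpoly : ∀ p : Poly N ν, algebraMap (RatField N ν) (AlgField N ν)
      (algebraMap (Poly N ν) (RatField N ν) p) ∈ A := fun p => by
    induction p using MvPolynomial.induction_on with
    | C a =>
      have : algebraMap (RatField N ν) (AlgField N ν)
          (algebraMap (Poly N ν) (RatField N ν) (MvPolynomial.C a)) = algebraMap ℂ _ a := by
        rw [IsScalarTower.algebraMap_apply ℂ (RatField N ν) (AlgField N ν),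
          IsScalarTower.algebraMap_apply ℂ (Poly N ν) (RatField N ν)]
        rfl
      rw [this]
      exact A.algebraMap_mem a
    | add p q hp hq => rw [map_add, map_add]; exact add_mem hp hq
    | mul_X p x hp => rw [map_mul, map_mul]; exact mul_mem hp (h x)
  have hrat : ∀ a : RatField N ν, algebraMap (RatField N ν) (AlgField N ν) a ∈ A := fun a => by
    obtain ⟨p, q, -, rfl⟩ := IsFractionRing.div_surjective (A := Poly N ν) a
    rw [map_div₀]
    exact div_mem (hpoly p) (hpoly q)
  refine hA z ?_
  have hz := AlgebraicClosure.isAlgebraic (RatField N ν) |>.isAlgebraic z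
  obtain ⟨p, hp, hpz⟩ := hz
  let φ : RatField N ν →+* A := (algebraMap (RatField N ν) (AlgField N ν)).codRestrict A hrat
  refine ⟨p.map φ, (Polynomial.map_ne_zero_iff φ.injective).2 hp, ?_⟩
  rw [Polynomial.aeval_def, Polynomial.eval₂_map]
  exact hpz

/-- As many elements as there are variables are algebraically independent as soon as all variables
are algebraic over them. -/
theorem algebraicIndependent_of_forall_coord_mem {y : Var N ν → AlgField N ν}
    (h : ∀ A : IntermediateField ℂ (AlgField N ν), A.IsRelAlgClosed → (∀ x, y x ∈ A) →
      ∀ x, coord x ∈ A) : AlgebraicIndependent ℂ y := by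
  have hle : Cardinal.mk (Var N ν) ≤ Algebra.trdeg ℂ (AlgField N ν) :=
    coord_algebraicIndependent.cardinalMk_le_trdeg
  have halg : Algebra.IsAlgebraic (Algebra.adjoin ℂ (Set.range y)) (AlgField N ν) := by
    refine ⟨fun z => ?_⟩
    let K := adjoin ℂ (Set.range y)
    have hz := mem_of_forall_coord_mem (isRelAlgClosed_algebraicClosure (F := ℂ)
      (E := AlgField N ν) K) (h _ (isRelAlgClosed_algebraicClosure K) fun x => by
        rw [mem_restrictScalars, mem_algebraicClosure_iff]
        exact isAlgebraic_algebraMap (⟨y x, subset_adjoin _ _ ⟨x, rfl⟩⟩ : K)) z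
    rw [mem_restrictScalars, mem_algebraicClosure_iff] at hz
    exact (IsFractionRing.isAlgebraic_iff (Algebra.adjoin ℂ (Set.range y)) K _).2 hz
  -- A finite family over which everything is algebraic contains a transcendence basis; having no
  -- more members than the transcendence degree, it is one.
  exact (Algebra.IsAlgebraic.isTranscendenceBasis_of_le_trdeg_of_finite ℂ y hle).1

theorem relVel_sq_ne_zero {y : Var N ν → AlgField N ν} (hy : AlgebraicIndependent ℂ y)
    (hν : 0 < ν) {i j : Fin N} (hij : i ≠ j) :
    ((fun c => y (Var.vel i c) - y (Var.vel j c)) ⬝ᵥ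
      fun c => y (Var.vel i c) - y (Var.vel j c)) ≠ 0 := by
  intro h
  have h0 : (∑ c, (MvPolynomial.X (Var.vel i c) - MvPolynomial.X (Var.vel j c)) *
      (MvPolynomial.X (Var.vel i c) - MvPolynomial.X (Var.vel j c)) : Poly N ν) = 0 :=
    hy (by simpa [dotProduct] using h)
  classical
  -- With one velocity component of ball `i` equal to 1 and all other variables 0, the sum of
  -- squares is 1.
  have := congrArg (MvPolynomial.eval fun x =>
    if x = Var.vel i ⟨0, hν⟩ then (1 : ℂ) else 0) h0
  simp [hij.symm] at this

/-- All positions and velocities lie in the given field. -/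
def State.Mem (A : IntermediateField ℂ (AlgField N ν)) (s : State N ν) : Prop :=
  (∀ b c, s.q b c ∈ A) ∧ ∀ b c, s.v b c ∈ A

/-- The field contains the size of the torus and the mass ratios, hence all parameters of the
equations of motion. -/
def HasParameters (A : IntermediateField ℂ (AlgField N ν)) : Prop :=
  coord Var.size ∈ A ∧
    ∀ i j, i ≠ j → coord (Var.mass i) / (coord (Var.mass i) + coord (Var.mass j)) ∈ A

/-! ### Flights and collisions inside a subfield -/

namespace CollisionScheme

variable (C : CollisionScheme N ν n) {A : IntermediateField ℂ (AlgField N ν)}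

theorem relPos_mem (hL : coord Var.size ∈ A) (k : Fin n) {s : State N ν}
    (hs : ∀ b c, s.q b c ∈ A) (c : Fin ν) : C.relPos k s c ∈ A :=
  sub_mem (sub_mem (hs _ _) (hs _ _)) (mul_mem hL (intCast_mem _ _))

theorem relVel_mem (k : Fin n) {s : State N ν}
    (hs : ∀ b c, s.v b c ∈ A) (c : Fin ν) : C.relVel k s c ∈ A :=
  sub_mem (hs _ _) (hs _ _)

theorem flight_mem {t : AlgField N ν} (ht : t ∈ A) {s : State N ν} (hs : s.Mem A) :
    (flight t s).Mem A :=
  ⟨fun b c => add_mem (hs.1 b c) (mul_mem ht (hs.2 b c)), hs.2⟩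

theorem mem_of_flight_mem {t : AlgField N ν} (ht : t ∈ A) {s : State N ν}
    (hs : (flight t s).Mem A) : s.Mem A := by
  refine ⟨fun b c => ?_, hs.2⟩
  have := sub_mem (hs.1 b c) (mul_mem ht (hs.2 b c))
  simpa [flight] using this

/-- The impulse of the `k`-th collision. -/
def impulse (r : ℝ) (k : Fin n) (s : State N ν) (c : Fin ν) : AlgField N ν :=
  algebraMap ℂ (AlgField N ν) ((1 / (2 * r ^ 2) : ℝ) : ℂ) *
    (C.relVel k s ⬝ᵥ C.relPos k s) * C.relPos k s c

theorem collide_v (r : ℝ) (k : Fin n) (s : State N ν) (b : Fin N) (c : Fin ν) :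
    (C.collide r k s).v b c =
      if b = C.i k then s.v b c - coord (Var.mass (C.j k)) /
        (coord (Var.mass (C.j k)) + coord (Var.mass (C.i k))) * C.impulse r k s c
      else if b = C.j k then s.v b c + coord (Var.mass (C.i k)) /
        (coord (Var.mass (C.i k)) + coord (Var.mass (C.j k))) * C.impulse r k s c
      else s.v b c := by
  rw [add_comm (coord (Var.mass (C.j k)))]
  rfl

/-- A collision shifts velocities by mass ratios times the impulse, so it can be undone once the
impulse is known. -/
theorem collide_mem_iff (hA : HasParameters A) {r : ℝ} {k : Fin n} {s : State N ν}
    (hJ : ∀ c, C.impulse r k s c ∈ A) : (C.collide r k s).Mem A ↔ s.Mem A := by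
  have h1 := fun c => mul_mem (hA.2 _ _ (C.ne k).symm) (hJ c)
  have h2 := fun c => mul_mem (hA.2 _ _ (C.ne k)) (hJ c)
  refine and_congr Iff.rfl (forall_congr' fun b => forall_congr' fun c => ?_)
  rw [collide_v]
  split_ifs
  · exact ⟨fun h => by simpa using add_mem h (h1 c), fun h => sub_mem h (h1 c)⟩
  · exact ⟨fun h => by simpa using sub_mem h (h2 c), fun h => add_mem h (h2 c)⟩
  · rfl

theorem relVel_collide (r : ℝ) (k : Fin n) (s : State N ν) (c : Fin ν) :
    C.relVel k (C.collide r k s) c = C.relVel k s c - C.impulse r k s c := by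
  have hM := mass_add_mass_ne_zero (ν := ν) (C.ne k)
  rw [relVel, collide_v, collide_v, if_pos rfl, if_neg (C.ne k).symm, if_pos rfl, relVel,
    add_comm (coord (Var.mass (C.j k)))]
  field_simp
  ring

theorem collide_mem (hA : HasParameters A) (r : ℝ) (k : Fin n) {s : State N ν}
    (hs : s.Mem A) : (C.collide r k s).Mem A :=
  (C.collide_mem_iff hA fun c => mul_mem (mul_mem (A.algebraMap_mem _)
    (dotProduct_mem_of_forall_mem (C.relVel_mem k hs.2) (C.relPos_mem hA.1 k hs.1)))
      (C.relPos_mem hA.1 k hs.1 c)).2 hs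

/-- At contact, a collision reverses the normal component of the relative velocity. -/
theorem relVel_collide_dotProduct {r : ℝ} (hr : 0 < r) {k : Fin n} {s : State N ν}
    (hu : C.relPos k s ⬝ᵥ C.relPos k s = algebraMap ℂ (AlgField N ν) ((4 * r ^ 2 : ℝ) : ℂ)) :
    C.relVel k (C.collide r k s) ⬝ᵥ C.relPos k s = -(C.relVel k s ⬝ᵥ C.relPos k s) := by
  have h : C.relVel k (C.collide r k s) = C.relVel k s -
      (algebraMap ℂ (AlgField N ν) ((1 / (2 * r ^ 2) : ℝ) : ℂ) *
        (C.relVel k s ⬝ᵥ C.relPos k s)) • C.relPos k s := by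
    funext c
    exact C.relVel_collide r k s c
  have hr2 : algebraMap ℂ (AlgField N ν) ((1 / (2 * r ^ 2) : ℝ) : ℂ) *
      algebraMap ℂ (AlgField N ν) ((4 * r ^ 2 : ℝ) : ℂ) = 2 := by
    rw [← map_mul, ← Complex.ofReal_mul,
      show 1 / (2 * r ^ 2) * (4 * r ^ 2) = 2 by field_simp; norm_num,
      Complex.ofReal_ofNat, map_ofNat]
  rw [h, sub_dotProduct, smul_dotProduct, hu, smul_eq_mul, mul_right_comm, hr2]
  ring

/-- Collisions at contact are reversible. -/
theorem mem_of_collide_mem (hA : HasParameters A) {r : ℝ} (hr : 0 < r) {k : Fin n}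
    {s : State N ν}
    (hu : C.relPos k s ⬝ᵥ C.relPos k s = algebraMap ℂ (AlgField N ν) ((4 * r ^ 2 : ℝ) : ℂ))
    (hs : (C.collide r k s).Mem A) : s.Mem A := by
  have hpos : ∀ c, C.relPos k s c ∈ A := C.relPos_mem hA.1 k (s := C.collide r k s) hs.1
  refine (C.collide_mem_iff hA fun c => ?_).1 hs
  refine mul_mem (mul_mem (A.algebraMap_mem _) ?_) (hpos c)
  have := dotProduct_mem_of_forall_mem (C.relVel_mem k hs.2) hpos
  rw [C.relVel_collide_dotProduct hr hu] at this
  simpa using neg_mem this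

theorem relPos_flight (k : Fin n) (t : AlgField N ν) (s : State N ν) :
    C.relPos k (flight t s) = C.relPos k s + t • C.relVel k s := by
  funext c
  simp only [relPos, flight, relVel, Pi.add_apply, Pi.smul_apply, smul_eq_mul]
  ring

theorem relPos_flight_sq (k : Fin n) (t : AlgField N ν) (s : State N ν) :
    C.relPos k (flight t s) ⬝ᵥ C.relPos k (flight t s) =
      (C.relVel k s ⬝ᵥ C.relVel k s) * t ^ 2 + 2 * (C.relVel k s ⬝ᵥ C.relPos k s) * t +
        C.relPos k s ⬝ᵥ C.relPos k s := by
  rw [relPos_flight]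
  simp only [add_dotProduct, dotProduct_add, smul_dotProduct, dotProduct_smul, smul_eq_mul,
    dotProduct_comm (C.relPos k s) (C.relVel k s)]
  ring

theorem orbit_succ (r : ℝ) (τ : Fin n → AlgField N ν) (k : Fin n) :
    C.orbit r τ (k + 1) = C.collide r k (flight (τ k) (C.orbit r τ k)) := by
  simp [orbit]

end CollisionScheme

end HardBall

end

noncomputable section

namespace HardBall

open IntermediateField

variable {N ν n : ℕ}

/-! ### Non-degeneracy of the collision equations -/

namespace OrbitStructure

variable {r : ℝ} (S : OrbitStructure N ν n r)

/-- The balls of the `k`-th collision are at distance `2 r` when they collide. -/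
theorem contact (k : Fin n) :
    S.relPos k (CollisionScheme.flight (S.τ k) (S.orbit r S.τ k)) ⬝ᵥ
      S.relPos k (CollisionScheme.flight (S.τ k) (S.orbit r S.τ k)) =
        algebraMap ℂ (AlgField N ν) ((4 * r ^ 2 : ℝ) : ℂ) := by
  have h := S.root k
  rw [CollisionScheme.relPos_flight_sq]
  linear_combination h

theorem relPos_orbit_succ_sq (k : Fin n) :
    S.relPos k (S.orbit r S.τ (k + 1)) ⬝ᵥ S.relPos k (S.orbit r S.τ (k + 1)) =
      algebraMap ℂ (AlgField N ν) ((4 * r ^ 2 : ℝ) : ℂ) := by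
  rw [CollisionScheme.orbit_succ]
  exact S.contact k

/-- All initial data are algebraic over the parameters, the `(k + 1)`-st state, and the time of
the first collision. -/
def InitialDataAlgebraicOver (k : ℕ) : Prop :=
  ∀ A : IntermediateField ℂ (AlgField N ν), A.IsRelAlgClosed → coord Var.size ∈ A →
    (∀ i, coord (Var.mass i) ∈ A) → (S.orbit r S.τ (k + 1)).Mem A →
      (∀ h : 0 < n, S.τ ⟨0, h⟩ ∈ A) → ∀ x, coord x ∈ A

/-- The velocities after the collision belong to a family as large as the set of variables over
which all initial data are algebraic, so they are independent. Any pair `i ≠ j` is allowed, since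
both the pair that has just collided and the next one are needed. -/
theorem relVel_orbit_succ_sq_ne_zero (hν : 0 < ν) (k : Fin n)
    (hk : S.InitialDataAlgebraicOver k) {i j : Fin N} (hij : i ≠ j) :
    ((fun c => S.V (k + 1) i c - S.V (k + 1) j c) ⬝ᵥ
      fun c => S.V (k + 1) i c - S.V (k + 1) j c) ≠ 0 := by
  classical
  let c₀ : Fin ν := ⟨0, hν⟩
  let t₀ : AlgField N ν := S.τ ⟨0, k.pos⟩
  -- The contact condition makes one position coordinate redundant; its slot is given to the first
  -- collision time, which keeps the count right.
  let y : Var N ν → AlgField N ν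
    | .pos b c => if b = S.i k ∧ c = c₀ then t₀ else (S.orbit r S.τ (k + 1)).q b c
    | .vel b c => S.V (k + 1) b c
    | .mass b => coord (.mass b)
    | .size => coord .size
  refine relVel_sq_ne_zero (y := y) (algebraicIndependent_of_forall_coord_mem fun A hA hy => ?_)
    hν hij
  have ht : t₀ ∈ A := by simpa [y] using hy (.pos (S.i k) c₀)
  have hL : coord Var.size ∈ A := hy .size
  have hq : ∀ b c, ¬(b = S.i k ∧ c = c₀) → (S.orbit r S.τ (k + 1)).q b c ∈ A := fun b c hbc => by
    simpa [y, hbc] using hy (.pos b c)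
  have hu : ∀ c, c ≠ c₀ → S.relPos k (S.orbit r S.τ (k + 1)) c ∈ A := fun c hc =>
    sub_mem (sub_mem (hq _ _ (by simp [hc])) (hq _ _ (by simp [hc])))
      (mul_mem hL (intCast_mem _ _))
  have hu₀ : S.relPos k (S.orbit r S.τ (k + 1)) c₀ ∈ A := by
    have h := S.relPos_orbit_succ_sq k
    rw [dotProduct, ← Finset.add_sum_erase _ _ (Finset.mem_univ c₀)] at h
    refine hA.mem_of_quadratic (one_mem A) (zero_mem A) (c := ∑ c ∈ Finset.univ.erase c₀,
      S.relPos k (S.orbit r S.τ (k + 1)) c * S.relPos k (S.orbit r S.τ (k + 1)) c -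
        algebraMap ℂ (AlgField N ν) ((4 * r ^ 2 : ℝ) : ℂ)) (sub_mem (sum_mem fun c hc => ?_)
          (A.algebraMap_mem _)) one_ne_zero (by linear_combination h)
    exact mul_mem (hu c (Finset.ne_of_mem_erase hc)) (hu c (Finset.ne_of_mem_erase hc))
  refine hk A hA hL (fun i => hy (.mass i)) ⟨fun b c => ?_, fun b c => hy (.vel b c)⟩ fun _ => ht
  by_cases hbc : b = S.i k ∧ c = c₀
  · obtain ⟨rfl, rfl⟩ := hbc
    have := add_mem (add_mem hu₀ (hq (S.j k) c₀ (by simp [(S.ne k).symm])))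
      (mul_mem hL (intCast_mem A (S.a k c₀)))
    rw [CollisionScheme.relPos] at this
    ring_nf at this ⊢
    exact this
  · exact hq b c hbc

/-- The orbit is traced backwards: collisions at contact are reversible, and each flight time except
the first is determined, up to finitely many choices, by contact of the previous pair at its start.
-/
theorem initialDataAlgebraicOver (hν : 0 < ν) (hr : 0 < r) (k : ℕ) (hk : k < n) :
    S.InitialDataAlgebraicOver k := by
  induction k with
  | zero =>
    intro A hA hL hm hs ht
    have hpar : HasParameters A := ⟨hL, fun i j _ => div_mem (hm i) (add_mem (hm i) (hm j))⟩
    have h0 := CollisionScheme.mem_of_flight_mem (ht hk) (s := S.orbit r S.τ 0)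
      (S.mem_of_collide_mem hpar hr (S.contact ⟨0, hk⟩)
        (by rw [← CollisionScheme.orbit_succ]; exact hs))
    rintro (⟨b, c⟩ | ⟨b, c⟩ | b | _)
    exacts [h0.1 b c, h0.2 b c, hm b, hL]
  | succ k ih =>
    have hk' : k < n := Nat.lt_of_succ_lt hk
    intro A hA hL hm hs ht
    have hpar : HasParameters A := ⟨hL, fun i j _ => div_mem (hm i) (add_mem (hm i) (hm j))⟩
    have h0 := S.mem_of_collide_mem hpar hr (S.contact ⟨k + 1, hk⟩)
        (by rw [← CollisionScheme.orbit_succ]; exact hs)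
    have hsq := S.relPos_orbit_succ_sq ⟨k, hk'⟩
    simp only at hsq
    set s := S.orbit r S.τ (k + 1)
    set t := S.τ ⟨k + 1, hk⟩
    have hflight : s = CollisionScheme.flight (-t) (CollisionScheme.flight t s) := by
      simp [CollisionScheme.flight]
    have hw : ∀ c, S.relVel ⟨k, hk'⟩ (CollisionScheme.flight t s) c ∈ A := S.relVel_mem _ h0.2
    have hu : ∀ c, S.relPos ⟨k, hk'⟩ (CollisionScheme.flight t s) c ∈ A :=
      S.relPos_mem hL _ h0.1
    rw [hflight, CollisionScheme.relPos_flight_sq] at hsq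
    -- Flying back for time `t` must restore the distance `2 r` of pair `k`. Flight keeps
    -- velocities, so the leading coefficient is the squared relative velocity of that pair after
    -- its collision, nonzero by `ih`.
    have htA : t ∈ A := hA.mem_of_quadratic (dotProduct_mem_of_forall_mem hw hw)
      (b := -(2 * (S.relVel ⟨k, hk'⟩ (CollisionScheme.flight t s) ⬝ᵥ
        S.relPos ⟨k, hk'⟩ (CollisionScheme.flight t s))))
      (neg_mem (mul_mem (ofNat_mem A 2) (dotProduct_mem_of_forall_mem hw hu)))
      (sub_mem (dotProduct_mem_of_forall_mem hu hu)
        (A.algebraMap_mem ((4 * r ^ 2 : ℝ) : ℂ)))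
      (S.relVel_orbit_succ_sq_ne_zero hν ⟨k, hk'⟩ (ih hk') (S.ne _))
      (by linear_combination hsq)
    exact ih hk' A hA hL hm (CollisionScheme.mem_of_flight_mem htA h0) ht

/-- The quadratic equations of the collision times do not degenerate. -/
theorem relVel_sq_ne_zero (hν : 0 < ν) (hr : 0 < r) (k : Fin n) :
    S.relVel k (S.orbit r S.τ k) ⬝ᵥ S.relVel k (S.orbit r S.τ k) ≠ 0 := by
  obtain ⟨_ | k, hk⟩ := k
  · exact HardBall.relVel_sq_ne_zero coord_algebraicIndependent hν (S.ne _)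
  · exact S.relVel_orbit_succ_sq_ne_zero hν ⟨k, Nat.lt_of_succ_lt hk⟩
      (S.initialDataAlgebraicOver hν hr k (Nat.lt_of_succ_lt hk)) (S.ne _)

theorem orbit_mem (hν : 0 < ν) (hr : 0 < r) {A : IntermediateField ℂ (AlgField N ν)}
    (hA : A.IsRelAlgClosed) (hpar : HasParameters A) (h0 : (S.orbit r S.τ 0).Mem A) (k : ℕ) :
    (S.orbit r S.τ k).Mem A := by
  induction k with
  | zero => exact h0
  | succ k ih =>
    by_cases hk : k < n
    · have hw := S.relVel_mem ⟨k, hk⟩ ih.2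
      have hu := S.relPos_mem hpar.1 ⟨k, hk⟩ ih.1
      have ht : S.τ ⟨k, hk⟩ ∈ A := hA.mem_of_quadratic (dotProduct_mem_of_forall_mem hw hw)
        (mul_mem (ofNat_mem A 2) (dotProduct_mem_of_forall_mem hw hu))
        (sub_mem (dotProduct_mem_of_forall_mem hu hu) (A.algebraMap_mem _))
        (S.relVel_sq_ne_zero hν hr ⟨k, hk⟩) (S.root ⟨k, hk⟩)
      have := S.collide_mem hpar r ⟨k, hk⟩ (CollisionScheme.flight_mem ht ih)
      rwa [← CollisionScheme.orbit_succ] at this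
    · rwa [CollisionScheme.orbit, dif_neg hk]

theorem minors_subset {A : IntermediateField ℂ (AlgField N ν)}
    (h : ∀ k, (S.orbit r S.τ k).Mem A) : S.minors ⊆ A := by
  have hV : ∀ k b c, S.V k b c ∈ A := fun k => (h k).2
  have hT : ∀ x : (Fin N × Fin ν) ⊕ Fin n → AlgField N ν, (∀ i, x i ∈ A) →
      ∀ k b c, S.transported x k b c ∈ A := fun x hx k b c =>
    add_mem (hx _) (sum_mem fun l _ => mul_mem (hx _) (sub_mem (hV _ _ _) (hV _ _ _)))
  have hentry : ∀ p q, LinearMap.toMatrix' S.neutralityMap p q ∈ A := fun p q => by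
    rw [LinearMap.toMatrix'_apply]
    have hx : ∀ i, (Pi.single q 1 : (Fin N × Fin ν) ⊕ Fin n → AlgField N ν) i ∈ A := fun i => by
      rw [Pi.single_apply]
      split_ifs
      exacts [one_mem A, zero_mem A]
    exact sub_mem (sub_mem (hT _ hx _ _ _) (mul_mem (hx _) (hV _ _ _)))
      (sub_mem (hT _ hx _ _ _) (mul_mem (hx _) (hV _ _ _)))
  rintro _ ⟨row, col, rfl⟩
  rw [SetLike.mem_coe, Matrix.det_apply]
  exact sum_mem fun σ _ => zsmul_mem (prod_mem fun i _ => hentry _ _) _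

end OrbitStructure

/-! ### Doubling the masses -/

theorem pow_right_injective_two :
    Function.Injective fun m : ℕ => ((Units.mk0 2 two_ne_zero : ℂˣ) : ℂ) ^ m := fun a b h => by
  refine Nat.pow_right_injective le_rfl ?_
  have h : (2 : ℂ) ^ a = 2 ^ b := h
  exact_mod_cast h

/-- The automorphism of the field of rational functions that doubles all masses. -/
def doubleMasses : Gal(RatField N ν/ℂ) :=
  IsFractionRing.fieldEquivOfAlgEquiv ℂ (RatField N ν) (RatField N ν)
    (MvPolynomial.weightScale massWeight (Units.mk0 (2 : ℂ) two_ne_zero) : Poly N ν ≃ₐ[ℂ] Poly N ν)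

theorem doubleMasses_algebraMap (p : Poly N ν) :
    doubleMasses (algebraMap (Poly N ν) (RatField N ν) p) =
      algebraMap (Poly N ν) (RatField N ν)
        (MvPolynomial.weightScale massWeight (Units.mk0 (2 : ℂ) two_ne_zero) p) :=
  IsFractionRing.fieldEquivOfAlgEquiv_algebraMap ℂ (RatField N ν) (RatField N ν) _ p

theorem doubleMasses_pow_algebraMap (k : ℕ) (p : Poly N ν) :
    (doubleMasses ^ k) (algebraMap (Poly N ν) (RatField N ν) p) =
      algebraMap (Poly N ν) (RatField N ν)
        ((MvPolynomial.weightScale massWeight (Units.mk0 (2 : ℂ) two_ne_zero) ^ k) p) := by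
  induction k with
  | zero => simp
  | succ k ih =>
    rw [pow_succ', AlgEquiv.mul_apply, ih, doubleMasses_algebraMap, pow_succ', AlgEquiv.mul_apply]

/-- The algebraic functions that are algebraic over the rational functions invariant under
scaling of the masses. -/
def massInvariant (N ν : ℕ) : IntermediateField ℂ (AlgField N ν) :=
  (algebraicClosure (fixedField (Subgroup.zpowers (doubleMasses (N := N) (ν := ν))))
    (AlgField N ν)).restrictScalars ℂ

theorem algebraMap_mem_massInvariant {a : RatField N ν} (ha : doubleMasses a = a) :
    algebraMap (RatField N ν) (AlgField N ν) a ∈ massInvariant N ν := by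
  rw [massInvariant, mem_restrictScalars, mem_algebraicClosure_iff]
  refine isAlgebraic_algebraMap (A := AlgField N ν)
    (⟨a, (mem_fixedField_iff _ _).2 fun f hf => ?_⟩ :
      fixedField (Subgroup.zpowers (doubleMasses (N := N) (ν := ν))))
  have : Subgroup.zpowers doubleMasses ≤ MulAction.stabilizer Gal(RatField N ν/ℂ) a := by
    rw [Subgroup.zpowers_le]
    exact ha
  exact this hf

theorem coord_mem_massInvariant {x : Var N ν} (hx : massWeight x = 0) :
    coord x ∈ massInvariant N ν :=
  algebraMap_mem_massInvariant (by rw [doubleMasses_algebraMap]; simp [hx])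

theorem hasParameters_massInvariant : HasParameters (massInvariant N ν) := by
  refine ⟨coord_mem_massInvariant rfl, fun i j hij => ?_⟩
  rw [coord, coord, ← map_add, ← map_div₀]
  refine algebraMap_mem_massInvariant ?_
  rw [map_div₀, map_add, doubleMasses_algebraMap, doubleMasses_algebraMap]
  simp only [MvPolynomial.weightScale_X, massWeight, pow_one, Units.val_mk0,
    MvPolynomial.smul_eq_C_mul, map_mul, ← mul_add]
  -- The common factor 2 cancels in the mass ratio.
  refine mul_div_mul_left _ _ ?_
  simp

/-- Passing to the product of conjugates returns to rational functions, where σ acts; no extension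
of σ to the algebraic closure is needed. -/
theorem homogeneousInMasses_normNum {f : AlgField N ν} (hf : f ∈ massInvariant N ν) :
    HomogeneousInMasses (normNum f) := by
  rw [massInvariant, mem_restrictScalars, mem_algebraicClosure_iff] at hf
  have hc : IsAlgebraic (fixedField (Subgroup.zpowers (doubleMasses (N := N) (ν := ν))))
      (conjProd f) :=
    (((isAlgebraic_one).neg).pow _).mul (isAlgebraic_minpoly_coeff_zero hf)
  obtain ⟨k, hk, hfix⟩ := exists_pow_apply_eq_of_isAlgebraic_fixedField _ hc
  exact MvPolynomial.exists_isWeightedHomogeneous_of_associated massWeight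
    (t := Units.mk0 2 two_ne_zero) (pow_right_injective_two) hk
    (IsFractionRing.associated_num_of_fixed
      ((MvPolynomial.weightScale massWeight (Units.mk0 (2 : ℂ) two_ne_zero) ^ k :
        Poly N ν ≃ₐ[ℂ] Poly N ν) : Poly N ν ≃+* Poly N ν)
      (τ := ((doubleMasses ^ k : Gal(RatField N ν/ℂ)) : RatField N ν →+* RatField N ν))
      (doubleMasses_pow_algebraMap k) hfix)

end HardBall

end

theorem proposition3p2 (N ν n : ℕ) (hN : 2 ≤ N) (hν : 2 ≤ ν) (r : ℝ) (hr : 0 < r)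
    (S : HardBall.OrbitStructure N ν n r)
    (s : ℕ) (f : Fin s → HardBall.AlgField N ν) (hf : S.IsNonSufficiencySystem f) :
    (∀ k, HardBall.HomogeneousInMasses (HardBall.normNum (f k))) ∧
      ((∃ k, HardBall.normNum (f k) ≠ 0) →
        ∀ Q : HardBall.Poly N ν, (∀ k, Q ∣ HardBall.normNum (f k)) →
          HardBall.HomogeneousInMasses Q) := by
  have horbit := S.orbit_mem (by omega) hr
    (IntermediateField.isRelAlgClosed_algebraicClosure _) HardBall.hasParameters_massInvariant
    ⟨fun b c => HardBall.coord_mem_massInvariant rfl,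
      fun b c => HardBall.coord_mem_massInvariant rfl⟩
  have hmem : ∀ k, f k ∈ HardBall.massInvariant N ν := fun k => by
    -- The field contains ℂ, so it contains every complex combination of the minors.
    have hle : Submodule.span ℂ S.minors ≤
        (HardBall.massInvariant N ν).toSubalgebra.toSubmodule :=
      Submodule.span_le.2 (S.minors_subset horbit)
    exact hle (hf ▸ Submodule.subset_span ⟨k, rfl⟩)
  have hhom := fun k => HardBall.homogeneousInMasses_normNum (hmem k)
  refine ⟨hhom, fun ⟨k, hk⟩ Q hQ => ?_⟩
  obtain ⟨d, hd⟩ := hhom k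
  exact MvPolynomial.exists_isWeightedHomogeneous_of_dvd _ (t := Units.mk0 2 two_ne_zero)
    HardBall.pow_right_injective_two hk hd (hQ k)
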